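/- Let $A$ be a (not necessarily unital) C*-algebra. For $a,b\in A$ write $a\perp b$ if $ab=0$ and $ab^*=0$; for $T\subseteq A$ put $T^\perp=\{s\in A: t\perp s\text{ for all }t\in T\}$, and call the sets of the form $T^\perp$, $T\subseteq A$, the annihilators of $A$. For $S\subseteq A$ let $S^1_+$ be the set of positive elements of $S$ of norm at most $1$, and for $B,C\subseteq A$ let $$\|BC\|=\sup\{\|bc\|: b\in B^1_+,\ c\in C^1_+\}.$$ For a C*-subalgebra $B$ of $A$ let $\mathrm{sep}(B)=\inf\|BD\|$, the infimum being over all annihilators $D\neq\{0\}$ of $A$ (the infimum over the empty set, which occurs only for $A=\{0\}$, is read as $0$). (1) Let $\varepsilon>0$ and let $B$ and $C\neq\{0\}$ be C*-subalgebras of $A$ with $\|BC\|^2=\lambda<1$. Then there is an annihilator $D$ of $A$ with $$\|BD\|\le\varepsilon\qquad\text{and}\qquad\|CD\|^2\ge 1-\lambda-\varepsilon.$$ (2) For every C*-subalgebra $B$ of $A$, $\mathrm{sep}(B)$ is either $0$ or $1$. (3) Let $A$ be represented faithfully and non-degenerately on a Hilbert space $H$. Call a projection $p$ on $H$ open if it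 is the supremum of an increasing net in $A^1_+$. For a projection $p$ on $H$, let its interior be $p^\circ=\sup(pAp\cap A)^1_+$ and its closure be $\overline p=1-(1-p)^\circ$; call $p$ dense if $\overline p=1$, and regular if $\|ap\|=\|a\overline p\|$ for all $a\in A$. Then every open dense projection $p$ on $H$ either is regular or satisfies $$\inf\{\|ap\|: a\in A,\ \|a\|=1\}=0,$$ i.e. $p$ is maximally non-regular. -/

import Mathlib

universe u v

section Annihilators

variable {A : Type u} [NonUnitalCStarAlgebra A]

/-- `T^⊥`, the set of all `s` such that `t ⊥ s` for every `t ∈ T`, where `t ⊥ s` means that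
both `t s^* = 0` and `t s = 0`. -/
def perp (T : Set A) : Set A := {s | ∀ t ∈ T, t * star s = 0 ∧ t * s = 0}

/-- The annihilators of `A` are the sets of the form `T^⊥` for some `T ⊆ A`. -/
def IsAnnihilator (D : Set A) : Prop := ∃ T : Set A, D = perp T

/-- `S^1_+`, the set of positive elements of norm at most one in `S`. -/
def posUnitBall [PartialOrder A] (S : Set A) : Set A := {a | a ∈ S ∧ 0 ≤ a ∧ ‖a‖ ≤ 1}

/-- `‖BC‖`, the supremum of `‖b c‖` over all `b ∈ B^1_+` and `c ∈ C^1_+`. -/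
noncomputable def prodNorm [PartialOrder A] (B C : Set A) : ℝ :=
  sSup {r : ℝ | ∃ b ∈ posUnitBall B, ∃ c ∈ posUnitBall C, r = ‖b * c‖}

/-- The supremum defining `‖BC‖` is taken over a set that is bounded (by one). -/
theorem prodNorm_bddAbove [PartialOrder A] (B C : Set A) :
    BddAbove {r : ℝ | ∃ b ∈ posUnitBall B, ∃ c ∈ posUnitBall C, r = ‖b * c‖} := by
  refine ⟨1, ?_⟩
  rintro r ⟨b, hb, c, hc, rfl⟩
  exact (norm_mul_le b c).trans (mul_le_one₀ hb.2.2 (norm_nonneg c) hc.2.2)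

/-- The separation `sep(B)` of `B` from `A`: the infimum of `‖BD‖` over all nonzero
annihilators `D` of `A`. -/
noncomputable def sep [PartialOrder A] (B : Set A) : ℝ :=
  sInf {r : ℝ | ∃ D : Set A, IsAnnihilator D ∧ D ≠ {0} ∧ r = prodNorm B D}

end Annihilators

section Projections

variable {A : Type u} [NonUnitalCStarAlgebra A]
variable {H : Type v} [NormedAddCommGroup H] [InnerProductSpace ℂ H] [CompleteSpace H]

/-- A representation of `A` on `H` is non-degenerate if the vectors `π(a) x` span a dense
subspace of `H`. -/
def IsNondegenerateRep (π : A →⋆ₙₐ[ℂ] (H →L[ℂ] H)) : Prop :=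
  Dense (Submodule.span ℂ {y : H | ∃ (a : A) (x : H), y = π a x} : Set H)

/-- A projection `p` on `H` is open (with respect to `A`, represented on `H` by `π`) if it is the
supremum, in the usual order of operators, of an increasing net in `A^1_+`; the range of such a
net is a nonempty directed set, and each such set is an increasing net indexed by itself. -/
def IsOpenProjection [PartialOrder A] (π : A →⋆ₙₐ[ℂ] (H →L[ℂ] H)) (p : H →L[ℂ] H) : Prop :=
  IsStarProjection p ∧
    ∃ S : Set A, S ⊆ posUnitBall Set.univ ∧ S.Nonempty ∧ DirectedOn (· ≤ ·) S ∧ IsLUB (π '' S) p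

/-- `q` is the interior `p°` of the projection `p`, the supremum of `(pAp ∩ A)^1_+`. -/
def IsInteriorOf [PartialOrder A] (π : A →⋆ₙₐ[ℂ] (H →L[ℂ] H)) (p q : H →L[ℂ] H) : Prop :=
  IsLUB (π '' posUnitBall {a : A | ∃ x : A, π a = p * π x * p}) q

/-- `q` is the closure of the projection `p`, i.e. `1 - q` is the interior of `1 - p`. -/
def IsClosureOf [PartialOrder A] (π : A →⋆ₙₐ[ℂ] (H →L[ℂ] H)) (p q : H →L[ℂ] H) : Prop :=
  IsInteriorOf π (1 - p) (1 - q)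

/-- A projection is dense if its closure is the identity operator. -/
def IsDenseProjection [PartialOrder A] (π : A →⋆ₙₐ[ℂ] (H →L[ℂ] H)) (p : H →L[ℂ] H) : Prop :=
  IsClosureOf π p 1

/-- A projection `p` with closure `q` is regular if `‖a p‖ = ‖a q‖` for all `a ∈ A`. -/
def IsRegularProjection [PartialOrder A] (π : A →⋆ₙₐ[ℂ] (H →L[ℂ] H)) (p : H →L[ℂ] H) : Prop :=
  ∃ q : H →L[ℂ] H, IsClosureOf π p q ∧ ∀ a : A, ‖π a * p‖ = ‖π a * q‖

/-- A (dense) projection `p` is maximally non-regular if the infimum of `‖a p‖` over all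
`a ∈ A` with `‖a‖ = 1` is zero. -/
def IsMaximallyNonRegular (π : A →⋆ₙₐ[ℂ] (H →L[ℂ] H)) (p : H →L[ℂ] H) : Prop :=
  IsGLB {r : ℝ | ∃ a : A, ‖a‖ = 1 ∧ r = ‖π a * p‖} 0

end Projections

/-!
The heart of the matter is a construction of one positive element that is almost orthogonal to all
of `B` at once. Let `lam = ‖BC‖²` and choose positive contractions `b ∈ B` and `c ∈ C` with
`‖b c‖² > lam - δ`. Put `β = 2 b - b²`, so that `1 - β = (1 - b)²`, let `z = c β c`, and let `e` be a
spectral cut of `z` at level `lam - δ`. For any positive contraction `b' ∈ B` the element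
`1 - (1 - b) (1 - b'²) (1 - b) = β + (1 - b) b'² (1 - b)` is again a positive contraction in `B`, so
`c (1 - b) b'² (1 - b) c ≤ lam - z`. Hence `x = (1 - b) c e` satisfies `‖b' x‖² ≤ δ` for every `b'`.
At the same time `x^* c e` has norm at least about `1 - lam`, and `‖x‖²` is at most about `1 - lam`
(`exists_almost_orthogonal`).

Now take two spectral cuts `h` and `f` of `x x^*` at a low level that does not depend on `δ`, with
`h f = f`. Then `‖b' h‖` is small for all `b'`, and `‖c f‖²` is almost `1 - lam` (`exists_cut`).
If `lam = 0`, then `B` and `C` are orthogonal and cuts of an element of `C` do. The annihilator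
`{f}^⊥⊥` consists of elements on which `h` acts as a unit (`mul_eq_of_mem_perp_perp`),
so it is the required annihilator (`exists_annihilator`). Since annihilators are themselves
C*-subalgebras, applying this to `B` and an annihilator `C` with `‖BC‖ < 1` shows that `sep(B)`
is `0` or `1` (`sep_eq_zero_or_one`).

For an open projection `p` with `‖a p‖ < ‖a‖` for some `a`, one may assume `a ≥ 0`. The spectral
part of `a` near its norm gives a subalgebra `C` with `‖BC‖ < 1`, where `B = p A p ∩ A`
(`exists_subalgebra_prodNorm_lt_one`), and then `f` is almost orthogonal to `p`
(`norm_mul_openProjection_sq_le`).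
-/

/-! ### Spectral cuts -/

section Cuts

/-- The piecewise linear function that vanishes below `s`, is one above `t`, and is affine
in between. -/
noncomputable def ramp (s t x : ℝ) : ℝ := max 0 (min 1 ((x - s) / (t - s)))

/-- The quotient of `ramp s t` by the identity function; the denominator is truncated at `s`,
below which the numerator vanishes. -/
noncomputable def rampDiv (s t x : ℝ) : ℝ := ramp s t x / max x s

theorem ramp_nonneg (s t x : ℝ) : 0 ≤ ramp s t x := le_max_left _ _

theorem ramp_le_one (s t x : ℝ) : ramp s t x ≤ 1 :=
  max_le zero_le_one (min_le_left _ _)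

theorem ramp_of_le {s t x : ℝ} (hst : s < t) (hx : x ≤ s) : ramp s t x = 0 :=
  max_eq_left ((min_le_right _ _).trans
    (div_nonpos_of_nonpos_of_nonneg (by linarith) (by linarith)))

theorem ramp_of_ge {s t x : ℝ} (hst : s < t) (hx : t ≤ x) : ramp s t x = 1 := by
  have h : 1 ≤ (x - s) / (t - s) := by
    rw [le_div_iff₀ (by linarith)]; linarith
  simp [ramp, min_eq_left h]

theorem continuous_ramp (s t : ℝ) : Continuous (ramp s t) := by
  unfold ramp; fun_prop

theorem continuous_rampDiv {s : ℝ} (hs : 0 < s) (t : ℝ) : Continuous (rampDiv s t) :=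
  (continuous_ramp s t).div (by fun_prop) fun _ => (hs.trans_le (le_max_right _ _)).ne'

theorem rampDiv_nonneg {s : ℝ} (hs : 0 < s) (t x : ℝ) : 0 ≤ rampDiv s t x :=
  div_nonneg (ramp_nonneg s t x) (hs.le.trans (le_max_right _ _))

theorem rampDiv_le {s : ℝ} (hs : 0 < s) (t x : ℝ) : rampDiv s t x ≤ 1 / s :=
  div_le_div₀ zero_le_one (ramp_le_one s t x) hs (le_max_right _ _)

theorem mul_rampDiv {s t : ℝ} (hs : 0 < s) (hst : s < t) (x : ℝ) :
    x * rampDiv s t x = ramp s t x := by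
  rcases le_total x s with h | h
  · simp [rampDiv, ramp_of_le hst h]
  · rw [rampDiv, max_eq_left h]
    field_simp [(hs.trans_le h).ne']

variable {A : Type u} [NonUnitalCStarAlgebra A]

/-- The ramp function from `s` to `t`, applied to `d` by the functional calculus; a continuous
substitute for the spectral projection of `d` for `[t, ∞)`. -/
noncomputable def cut (s t : ℝ) (d : A) : A := cfcₙ (ramp s t) d

/-- The element `k(d)`, where `k(x) = ramp s t x / x`. -/
noncomputable def cutDiv (s t : ℝ) (d : A) : A := cfcₙ (rampDiv s t) d

theorem ramp_zero {s t : ℝ} (hs : 0 < s) (hst : s < t) : ramp s t 0 = 0 :=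
  ramp_of_le hst hs.le

theorem rampDiv_zero {s t : ℝ} (hs : 0 < s) (hst : s < t) : rampDiv s t 0 = 0 := by
  simp [rampDiv, ramp_zero hs hst]

theorem cut_isSelfAdjoint (s t : ℝ) (d : A) : IsSelfAdjoint (cut s t d) :=
  IsSelfAdjoint.cfcₙ

theorem cutDiv_isSelfAdjoint (s t : ℝ) (d : A) : IsSelfAdjoint (cutDiv s t d) :=
  IsSelfAdjoint.cfcₙ

theorem cut_nonneg [PartialOrder A] [StarOrderedRing A] (s t : ℝ) (d : A) : 0 ≤ cut s t d :=
  cfcₙ_nonneg fun x _ => ramp_nonneg s t x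

theorem norm_cut_le_one (s t : ℝ) (d : A) : ‖cut s t d‖ ≤ 1 :=
  norm_cfcₙ_le fun x _ => by
    rw [Real.norm_of_nonneg (ramp_nonneg s t x)]; exact ramp_le_one s t x

theorem cut_mul_cut {s t r : ℝ} (hs : 0 < s) (hst : s < t) (htr : t < r) (d : A) :
    cut s t d * cut t r d = cut t r d := by
  unfold cut
  rw [← cfcₙ_mul (ramp s t) (ramp t r) d (continuous_ramp s t).continuousOn
    (ramp_zero hs hst) (continuous_ramp t r).continuousOn (ramp_zero (hs.trans hst) htr)]
  refine cfcₙ_congr fun x _ => ?_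
  rcases le_total x t with h | h
  · simp [ramp_of_le htr h]
  · simp [ramp_of_ge hst h]

theorem cut_eq_mul_cutDiv {s t : ℝ} (hs : 0 < s) (hst : s < t) {d : A} (hd : IsSelfAdjoint d) :
    cut s t d = d * cutDiv s t d := by
  unfold cut cutDiv
  nth_rewrite 2 [← cfcₙ_id' ℝ d]
  rw [← cfcₙ_mul (fun x => x) (rampDiv s t) d continuousOn_id rfl
    (continuous_rampDiv hs t).continuousOn (rampDiv_zero hs hst)]
  exact cfcₙ_congr fun x _ => (mul_rampDiv hs hst x).symm

theorem cut_eq_cutDiv_mul {s t : ℝ} (hs : 0 < s) (hst : s < t) {d : A} (hd : IsSelfAdjoint d) :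
    cut s t d = cutDiv s t d * d := by
  have h := congrArg star (cut_eq_mul_cutDiv hs hst hd)
  rwa [star_mul, (cut_isSelfAdjoint s t d).star_eq, (cutDiv_isSelfAdjoint s t d).star_eq,
    hd.star_eq] at h

theorem norm_cutDiv_le {s : ℝ} (hs : 0 < s) (t : ℝ) (d : A) : ‖cutDiv s t d‖ ≤ 1 / s :=
  norm_cfcₙ_le fun x _ => by
    rw [Real.norm_of_nonneg (rampDiv_nonneg hs t x)]; exact rampDiv_le hs t x

theorem norm_cutDiv_mul_cut_le {s t : ℝ} (hs : 0 < s) (d : A) :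
    ‖cutDiv s t d * cut s t d‖ ≤ 1 / s := by
  have h := norm_mul_le (cutDiv s t d) (cut s t d)
  have h1 := norm_cut_le_one s t d
  have h2 := norm_cutDiv_le hs t d
  nlinarith [norm_nonneg (cutDiv s t d), norm_nonneg (cut s t d)]

/-- For `d = x x^*`, the norm of `x^* k(d)` is at most the supremum of the function
`√x k(x)`. -/
theorem norm_star_mul_cutDiv_sq_le {s t : ℝ} (hs : 0 < s) (hst : s < t) (x : A) :
    ‖star x * cutDiv s t (x * star x)‖ ^ 2 ≤ 1 / s := by
  have hd : IsSelfAdjoint (x * star x) := IsSelfAdjoint.mul_star_self x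
  have key : star (star x * cutDiv s t (x * star x)) * (star x * cutDiv s t (x * star x))
      = cutDiv s t (x * star x) * cut s t (x * star x) := by
    rw [cut_eq_mul_cutDiv hs hst hd, star_mul, star_star, (cutDiv_isSelfAdjoint s t _).star_eq]
    simp only [mul_assoc]
  rw [pow_two, ← CStarRing.norm_star_mul_self, key]
  exact norm_cutDiv_mul_cut_le hs _

/-- A cut at a low level of `d = x x^*` almost fixes `x`. -/
theorem norm_sub_cut_mul_sq_le {s t : ℝ} (hs : 0 < s) (hst : s < t) (x : A) :
    ‖x - cut s t (x * star x) * x‖ ^ 2 ≤ t := by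
  let _ : PartialOrder A := CStarAlgebra.spectralOrder A
  have : StarOrderedRing A := CStarAlgebra.spectralOrderedRing A
  set d := x * star x with hd_def
  have hd : IsSelfAdjoint d := IsSelfAdjoint.mul_star_self x
  have hd0 : 0 ≤ d := mul_star_self_nonneg x
  have hr := (continuous_ramp s t)
  have hr0 := ramp_zero hs hst
  have key : (x - cut s t d * x) * star (x - cut s t d * x)
      = cfcₙ (fun y : ℝ => (y - ramp s t y * y) - (y - ramp s t y * y) * ramp s t y) d := by
    have e1 : cut s t d * d = cfcₙ (fun y : ℝ => ramp s t y * y) d := by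
      unfold cut
      rw [cfcₙ_mul (ramp s t) (fun y => y) d hr.continuousOn hr0 continuousOn_id rfl,
        cfcₙ_id' ℝ d]
    have e2 : d - cut s t d * d = cfcₙ (fun y : ℝ => y - ramp s t y * y) d := by
      rw [cfcₙ_sub (fun y : ℝ => y) (fun y => ramp s t y * y) d continuousOn_id rfl
        (hr.mul continuous_id).continuousOn (by simp), cfcₙ_id' ℝ d, e1]
    rw [cfcₙ_sub (fun y : ℝ => y - ramp s t y * y)
        (fun y => (y - ramp s t y * y) * ramp s t y) d (by fun_prop) (by simp)
        (by fun_prop) (by simp),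
      cfcₙ_mul (fun y : ℝ => y - ramp s t y * y) (ramp s t) d (by fun_prop) (by simp)
        (by fun_prop) hr0, ← e2]
    change _ = d - cut s t d * d - (d - cut s t d * d) * cut s t d
    rw [star_sub, star_mul, (cut_isSelfAdjoint s t d).star_eq, hd_def]
    noncomm_ring
  rw [pow_two, ← CStarRing.norm_self_mul_star, key]
  refine norm_cfcₙ_le fun y hy => ?_
  have hy0 : 0 ≤ y := quasispectrum_nonneg_of_nonneg d hd0 y hy
  have h0 := ramp_nonneg s t y
  have h1 := ramp_le_one s t y
  have : (y - ramp s t y * y) - (y - ramp s t y * y) * ramp s t y = y * (1 - ramp s t y) ^ 2 := by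
    ring
  rw [this, Real.norm_of_nonneg (by positivity)]
  rcases le_total y t with h | h
  · calc y * (1 - ramp s t y) ^ 2 ≤ t * 1 :=
          mul_le_mul h (pow_le_one₀ (by linarith) (by linarith)) (by positivity) (by linarith)
      _ = t := mul_one t
  · rw [ramp_of_ge hst h]
    simp only [sub_self, ne_eq, OfNat.ofNat_ne_zero, not_false_eq_true, zero_pow, mul_zero]
    linarith

theorem norm_mem_quasispectrum_of_nonneg [PartialOrder A] [StarOrderedRing A] {a : A}
    (ha : 0 ≤ a) : ‖a‖ ∈ quasispectrum ℝ a := by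
  rw [Unitization.quasispectrum_eq_spectrum_inr' ℝ ℂ a, ← Unitization.norm_inr (𝕜 := ℂ)]
  exact CStarAlgebra.norm_mem_spectrum_of_nonneg (Unitization.inr_nonneg_iff.mpr ha)

theorem norm_cut_eq_one [PartialOrder A] [StarOrderedRing A] {s t : ℝ} (hs : 0 < s)
    (hst : s < t) {d : A} (hd : 0 ≤ d) (ht : t ≤ ‖d‖) : ‖cut s t d‖ = 1 := by
  refine le_antisymm (norm_cut_le_one s t d) ?_
  have h := norm_apply_le_norm_cfcₙ (ramp s t) d (norm_mem_quasispectrum_of_nonneg hd)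
    (continuous_ramp s t).continuousOn (ramp_zero hs hst) (IsSelfAdjoint.of_nonneg hd)
  rwa [ramp_of_ge hst ht, norm_one] at h

/-- On the support of a cut of `z` at level `s`, the element `z` is at least `s`. -/
theorem smul_cut_sq_le [PartialOrder A] [StarOrderedRing A] {s t : ℝ} (hs : 0 < s)
    (hst : s < t) {z : A} (hz : IsSelfAdjoint z) :
    s • (cut s t z * cut s t z) ≤ cut s t z * z * cut s t z := by
  have hr := continuous_ramp s t
  have hr0 := ramp_zero hs hst
  have e1 : cut s t z * cut s t z = cfcₙ (fun y => ramp s t y * ramp s t y) z := by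
    unfold cut
    rw [cfcₙ_mul (ramp s t) (ramp s t) z hr.continuousOn hr0 hr.continuousOn hr0]
  have e2 : cut s t z * z * cut s t z = cfcₙ (fun y => ramp s t y * y * ramp s t y) z := by
    rw [cfcₙ_mul (fun y => ramp s t y * y) (ramp s t) z (by fun_prop) (by simp)
      hr.continuousOn hr0, cfcₙ_mul (ramp s t) (fun y => y) z hr.continuousOn hr0
      continuousOn_id rfl, cfcₙ_id' ℝ z]
    rfl
  rw [e1, e2, ← cfcₙ_smul s (fun y => ramp s t y * ramp s t y) z (by fun_prop) (by simp [hr0])]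
  refine cfcₙ_mono (fun y _ => ?_) (by fun_prop) (by fun_prop) (by simp [hr0]) (by simp)
  rcases le_total y s with h | h
  · simp [ramp_of_le hst h]
  · have := mul_le_mul_of_nonneg_right h (mul_self_nonneg (ramp s t y))
    simp only [smul_eq_mul]
    linarith

theorem cut_mem (s t : ℝ) {N : NonUnitalStarSubalgebra ℂ A} (hN : IsClosed (N : Set A)) {d : A}
    (hdN : d ∈ N) : cut s t d ∈ N :=
  cfcₙ_mem (hs := hN) (𝕜' := ℂ) (ramp s t) hdN

/-- Positive elements have positive square roots in every closed *-subalgebra. -/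
theorem exists_sqrt_mem [PartialOrder A] [StarOrderedRing A] {N : NonUnitalStarSubalgebra ℂ A}
    (hN : IsClosed (N : Set A)) {y : A} (hy : y ∈ N) (hy0 : 0 ≤ y) (hy1 : ‖y‖ ≤ 1) :
    ∃ w ∈ posUnitBall (N : Set A), w * w = y := by
  have hww : cfcₙ Real.sqrt y * cfcₙ Real.sqrt y = y := by
    rw [← cfcₙ_mul Real.sqrt Real.sqrt y (by fun_prop) (by simp) (by fun_prop) (by simp)]
    conv_rhs => rw [← cfcₙ_id' ℝ y (IsSelfAdjoint.of_nonneg hy0)]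
    refine cfcₙ_congr fun t ht => Real.mul_self_sqrt ?_
    exact quasispectrum_nonneg_of_nonneg y hy0 t ht
  refine ⟨cfcₙ Real.sqrt y, ⟨cfcₙ_mem (hs := hN) (𝕜' := ℂ) Real.sqrt hy,
    cfcₙ_nonneg fun t _ => Real.sqrt_nonneg t, ?_⟩, hww⟩
  have hsa : IsSelfAdjoint (cfcₙ Real.sqrt y) := IsSelfAdjoint.cfcₙ
  have h := CStarRing.norm_star_mul_self (x := cfcₙ Real.sqrt y)
  rw [hsa.star_eq, hww] at h
  nlinarith [norm_nonneg (cfcₙ Real.sqrt y)]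

end Cuts

/-! ### Elements almost orthogonal to a subalgebra -/

section Core

variable {M : Type u} [CStarAlgebra M] [PartialOrder M] [StarOrderedRing M]
variable {B C N : NonUnitalStarSubalgebra ℂ M}

theorem posUnitBall_le_one {S : Set M} {a : M} (ha : a ∈ posUnitBall S) : a ≤ 1 :=
  (CStarAlgebra.norm_le_one_iff_of_nonneg a ha.2.1).mp ha.2.2

theorem mem_posUnitBall_of_le_one {S : Set M} {a : M} (haS : a ∈ S) (h0 : 0 ≤ a) (h1 : a ≤ 1) :
    a ∈ posUnitBall S :=
  ⟨haS, h0, (CStarAlgebra.norm_le_one_iff_of_nonneg a h0).mpr h1⟩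

theorem conj_le_smul_one {lam : ℝ} (hB : IsClosed (B : Set M))
    (hsup : ∀ b ∈ posUnitBall (B : Set M), ∀ c ∈ posUnitBall (C : Set M), ‖b * c‖ ^ 2 ≤ lam)
    {y c : M} (hy : y ∈ posUnitBall (B : Set M)) (hc : c ∈ posUnitBall (C : Set M)) :
    c * y * c ≤ lam • (1 : M) := by
  obtain ⟨w, hw, rfl⟩ := exists_sqrt_mem hB hy.1 hy.2.1 hy.2.2
  have h := CStarAlgebra.star_mul_le_algebraMap_norm_sq (a := w * c)
  rw [star_mul, (IsSelfAdjoint.of_nonneg hc.2.1).star_eq,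
    (IsSelfAdjoint.of_nonneg hw.2.1).star_eq] at h
  have h2 : algebraMap ℝ M (‖w * c‖ ^ 2) ≤ algebraMap ℝ M lam :=
    algebraMap_mono M (hsup w hw c hc)
  rw [← Algebra.algebraMap_eq_smul_one]
  refine le_trans (le_of_eq ?_) (h.trans h2)
  simp only [mul_assoc]

/-- The bound `c y c ≤ lam c` is stronger than `c y c ≤ lam`; it forces `c` to be nearly one where
`c y c` is nearly `lam`. -/
theorem conj_le_smul {lam : ℝ} (hB : IsClosed (B : Set M)) (hC : IsClosed (C : Set M))
    (hsup : ∀ b ∈ posUnitBall (B : Set M), ∀ c ∈ posUnitBall (C : Set M), ‖b * c‖ ^ 2 ≤ lam)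
    {y c : M} (hy : y ∈ posUnitBall (B : Set M)) (hc : c ∈ posUnitBall (C : Set M)) :
    c * y * c ≤ lam • c := by
  obtain ⟨w, hw, rfl⟩ := exists_sqrt_mem hC hc.1 hc.2.1 hc.2.2
  have h := conjugate_le_conjugate_of_nonneg (conj_le_smul_one hB hsup hy hw) hw.2.1
  simpa only [mul_smul_comm, smul_mul_assoc, mul_one, mul_assoc] using h

theorem mul_self_le_self {b : M} (h0 : 0 ≤ b) (h1 : b ≤ 1) : b * b ≤ b := by
  have e : b - b * b = b * (1 - b) * b + (1 - b) * b * (1 - b) := by noncomm_ring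
  rw [← sub_nonneg, e]
  exact add_nonneg (conjugate_nonneg_of_nonneg (sub_nonneg.mpr h1) h0)
    (conjugate_nonneg_of_nonneg h0 (sub_nonneg.mpr h1))

/-- If `b ∈ B` and `c ∈ C` almost attain the bound `lam` on `‖b c‖²`, then `x = (1 - b) c e`, with
`e` a spectral cut of `c (2 b - b²) c` near the top of its spectrum, is almost orthogonal to all
of `B` simultaneously. The algebra `N` contains `B` and `C` but not necessarily the unit. -/
theorem exists_almost_orthogonal_of_unital {lam δ : ℝ} (hB : IsClosed (B : Set M))
    (hC : IsClosed (C : Set M)) (hN : IsClosed (N : Set M)) (hBN : B ≤ N) (hCN : C ≤ N)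
    (hsup : ∀ b ∈ posUnitBall (B : Set M), ∀ c ∈ posUnitBall (C : Set M), ‖b * c‖ ^ 2 ≤ lam)
    (hlam1 : lam ≤ 1) (hδ : 0 < δ) (hδlam : δ < lam) {b c : M} (hb : b ∈ posUnitBall (B : Set M))
    (hc : c ∈ posUnitBall (C : Set M)) (hbc : lam - δ < ‖b * c‖ ^ 2) :
    ∃ x ∈ N, ∃ e ∈ N, ‖e‖ ≤ 1 ∧ (∀ b' ∈ posUnitBall (B : Set M), ‖b' * x‖ ^ 2 ≤ δ) ∧
      ‖x‖ ^ 2 ≤ 1 - lam + δ ∧ 1 - lam - 2 * (δ / lam) ≤ ‖star x * (c * e)‖ := by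
  have hb1 := posUnitBall_le_one hb
  have hc1 := posUnitBall_le_one hc
  have hbs := (IsSelfAdjoint.of_nonneg hb.2.1).star_eq
  have hcs := (IsSelfAdjoint.of_nonneg hc.2.1).star_eq
  have hbb := mul_self_le_self hb.2.1 hb1
  have h1b : 0 ≤ 1 - b := sub_nonneg.mpr hb1
  -- The element `β` satisfies `1 - β = (1 - b)²`.
  set β : M := b + (b - b * b) with hβ
  have hbβ : b ≤ β := le_add_of_nonneg_right (sub_nonneg.mpr hbb)
  have hβB : β ∈ B := add_mem hb.1 (sub_mem hb.1 (mul_mem hb.1 hb.1))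
  have hβ0 : 0 ≤ β := hb.2.1.trans hbβ
  have hβ1 : β ≤ 1 := by
    have e : 1 - β = (1 - b) * 1 * (1 - b) := by rw [hβ]; noncomm_ring
    rw [← sub_nonneg, e]
    exact conjugate_nonneg_of_nonneg zero_le_one h1b
  have hβu : β ∈ posUnitBall (B : Set M) := mem_posUnitBall_of_le_one hβB hβ0 hβ1
  set z : M := c * β * c with hz
  have hz0 : 0 ≤ z := conjugate_nonneg_of_nonneg hβ0 hc.2.1
  have hz1 : z ≤ lam • (1 : M) := conj_le_smul_one hB hsup hβu hc
  have hzc : z ≤ lam • c := conj_le_smul hB hC hsup hβu hc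
  have hzn : lam - δ < ‖z‖ := by
    refine hbc.trans_le ?_
    rw [pow_two, ← CStarRing.norm_star_mul_self]
    refine CStarAlgebra.norm_le_norm_of_nonneg_of_le (star_mul_self_nonneg _) ?_
    have e : star (b * c) * (b * c) = c * (b * b) * c := by
      rw [star_mul, hbs, hcs]; simp only [mul_assoc]
    rw [e]
    exact conjugate_le_conjugate_of_nonneg (hbb.trans hbβ) hc.2.1
  have hzN : z ∈ N := mul_mem (mul_mem (hCN hc.1) (hBN hβB)) (hCN hc.1)
  have hpos : 0 < lam - δ := by linarith
  set e : M := cut (lam - δ) ‖z‖ z with he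
  have he0 : 0 ≤ e := cut_nonneg _ _ _
  have hes := (cut_isSelfAdjoint (lam - δ) ‖z‖ z).star_eq
  rw [← he] at hes
  have hen : ‖e‖ = 1 := norm_cut_eq_one hpos hzn hz0 le_rfl
  have heN : e ∈ N := cut_mem _ _ hN hzN
  have heen : ‖e * e‖ = 1 := by
    have := CStarRing.norm_star_mul_self (x := e)
    rwa [hes, hen, mul_one] at this
  have hee : 0 ≤ e * e := by
    have := star_mul_self_nonneg e
    rwa [hes] at this
  have hze : (lam - δ) • (e * e) ≤ e * z * e := smul_cut_sq_le hpos hzn (IsSelfAdjoint.of_nonneg hz0)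
  have hez : e * z * e ≤ lam • (e * e) := by
    have := conjugate_le_conjugate_of_nonneg hz1 he0
    simpa only [mul_smul_comm, smul_mul_assoc, mul_one] using this
  refine ⟨c * e - b * (c * e), sub_mem (mul_mem (hCN hc.1) heN)
    (mul_mem (hBN hb.1) (mul_mem (hCN hc.1) heN)), e, heN, hen.le, fun b' hb' => ?_, ?_, ?_⟩
  · have hbs' := (IsSelfAdjoint.of_nonneg hb'.2.1).star_eq
    -- Since `y = 1 - (1 - b)(1 - b'²)(1 - b)` belongs to the positive unit ball of `B`, the gain
    -- from `β` to `y` is bounded by the distance from `z` to its largest possible value.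
    set y : M := β + (1 - b) * (b' * b') * (1 - b) with hy
    have hb'0 : 0 ≤ b' * b' := by
      have := star_mul_self_nonneg b'
      rwa [hbs'] at this
    have hyB : y ∈ B := by
      have e1 : y = β + (b' * b' - b * (b' * b') - (b' * b' - b * (b' * b')) * b) := by
        rw [hy]; noncomm_ring
      have h2 := mul_mem hb'.1 hb'.1
      have h3 := sub_mem h2 (mul_mem hb.1 h2)
      rw [e1]
      exact add_mem hβB (sub_mem h3 (mul_mem h3 hb.1))
    have hy0 : 0 ≤ y := add_nonneg hβ0 (conjugate_nonneg_of_nonneg hb'0 h1b)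
    have hy1 : y ≤ 1 := by
      have e1 : 1 - y = (1 - b) * (1 - b' * b') * (1 - b) := by rw [hy, hβ]; noncomm_ring
      rw [← sub_nonneg, e1]
      refine conjugate_nonneg_of_nonneg (sub_nonneg.mpr ?_) h1b
      exact (mul_self_le_self hb'.2.1 (posUnitBall_le_one hb')).trans (posUnitBall_le_one hb')
    have hcy := conj_le_smul_one hB hsup (mem_posUnitBall_of_le_one hyB hy0 hy1) hc
    have hecy := conjugate_le_conjugate_of_nonneg hcy he0
    have key : star (b' * (c * e - b * (c * e))) * (b' * (c * e - b * (c * e)))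
        = e * (c * y * c) * e - e * z * e := by
      rw [hy, hz]
      simp only [star_mul, star_sub, hbs, hcs, hbs', hes]
      noncomm_ring
    rw [pow_two, ← CStarRing.norm_star_mul_self]
    have hle : star (b' * (c * e - b * (c * e))) * (b' * (c * e - b * (c * e))) ≤ δ • (e * e) := by
      rw [key]
      have e2 : δ • (e * e) = e * (lam • 1) * e - (lam - δ) • (e * e) := by
        simp only [mul_smul_comm, smul_mul_assoc, mul_one]; module
      rw [e2]
      exact sub_le_sub hecy hze
    refine (CStarAlgebra.norm_le_norm_of_nonneg_of_le (star_mul_self_nonneg _) hle).trans ?_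
    rw [norm_smul, heen, mul_one, Real.norm_of_nonneg hδ.le]
  · have hcc : c * c ≤ 1 := (mul_self_le_self hc.2.1 hc1).trans hc1
    have hecc := conjugate_le_conjugate_of_nonneg hcc he0
    have key : star (c * e - b * (c * e)) * (c * e - b * (c * e))
        = e * (c * c) * e - e * z * e := by
      rw [hz, hβ]
      simp only [star_mul, star_sub, hbs, hcs, hes]
      noncomm_ring
    have hle : star (c * e - b * (c * e)) * (c * e - b * (c * e)) ≤ (1 - lam + δ) • (e * e) := by
      rw [key]
      have e2 : (1 - lam + δ) • (e * e) = e * 1 * e - (lam - δ) • (e * e) := by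
        rw [mul_one]; module
      rw [e2]
      exact sub_le_sub hecc hze
    have hn := CStarAlgebra.norm_le_norm_of_nonneg_of_le (star_mul_self_nonneg _) hle
    rw [norm_smul, heen, mul_one, CStarRing.norm_star_mul_self, ← pow_two, Real.norm_eq_abs] at hn
    rwa [abs_of_nonneg (by linarith)] at hn
  · have hlam0 : 0 < lam := hδ.trans hδlam
    set μ := δ / lam with hμ
    have hμl : lam * μ = δ := by rw [hμ]; field_simp
    have key : star (c * e - b * (c * e)) * (c * e) = e * (c * c) * e - e * (c * b * c) * e := by
      simp only [star_mul, star_sub, hbs, hcs, hes]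
      noncomm_ring
    have h1 : e * (c * b * c) * e ≤ lam • (e * e) :=
      (conjugate_le_conjugate_of_nonneg (conjugate_le_conjugate_of_nonneg hbβ hc.2.1) he0).trans hez
    have h2 : (1 - μ) • (e * e) ≤ e * c * e := by
      have h3 := hze.trans (conjugate_le_conjugate_of_nonneg hzc he0)
      have h4 := smul_le_smul_of_nonneg_left h3 (inv_nonneg.mpr hlam0.le)
      simp only [mul_smul_comm, smul_mul_assoc, smul_smul] at h4
      rwa [inv_mul_cancel₀ hlam0.ne', one_smul,
        show lam⁻¹ * (lam - δ) = 1 - μ by rw [hμ]; field_simp] at h4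
    have h3 : (2 : ℝ) • (e * c * e) - e * e ≤ e * (c * c) * e := by
      have h := conjugate_nonneg_of_nonneg (conjugate_nonneg_of_nonneg
        (zero_le_one (α := M)) (sub_nonneg.mpr hc1)) he0
      rw [← sub_nonneg]
      refine h.trans (le_of_eq ?_)
      simp only [two_smul]
      noncomm_ring
    have hle : (1 - lam - 2 * μ) • (e * e) ≤ star (c * e - b * (c * e)) * (c * e) := by
      rw [key]
      refine le_trans (le_of_eq ?_) (sub_le_sub ((sub_le_sub_right
        (smul_le_smul_of_nonneg_left h2 zero_le_two) _).trans h3) h1)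
      module
    rcases le_total (1 - lam - 2 * μ) 0 with h | h
    · exact h.trans (norm_nonneg _)
    · have hn := CStarAlgebra.norm_le_norm_of_nonneg_of_le (smul_nonneg h hee) hle
      rwa [norm_smul, heen, mul_one, Real.norm_of_nonneg h] at hn

end Core

/-! ### The non-unital case and the cuts `h` and `f` -/

section NonUnital

variable {A : Type u} [NonUnitalCStarAlgebra A]
variable {B C : NonUnitalStarSubalgebra ℂ A}

/-- The image of `B` in the unitization of `A`. -/
noncomputable abbrev inUnitization (B : NonUnitalStarSubalgebra ℂ A) :
    NonUnitalStarSubalgebra ℂ (Unitization ℂ A) :=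
  B.map (Unitization.inrNonUnitalStarAlgHom ℂ A)

theorem isClosed_map_inr (hB : IsClosed (B : Set A)) :
    IsClosed (inUnitization B : Set (Unitization ℂ A)) := by
  have h := (Unitization.isometry_inr (𝕜 := ℂ) (A := A)).isClosedEmbedding.isClosedMap _ hB
  simpa using h

variable [PartialOrder A]

theorem norm_mul_le_prodNorm {S T : Set A} {b c : A} (hb : b ∈ posUnitBall S)
    (hc : c ∈ posUnitBall T) : ‖b * c‖ ≤ prodNorm S T :=
  le_csSup (prodNorm_bddAbove S T) ⟨b, hb, c, hc, rfl⟩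

theorem prodNorm_nonneg (S T : Set A) : 0 ≤ prodNorm S T :=
  Real.sSup_nonneg (by rintro r ⟨b, -, c, -, rfl⟩; exact norm_nonneg _)

theorem prodNorm_le {S T : Set A} {r : ℝ} (hr : 0 ≤ r)
    (h : ∀ b ∈ posUnitBall S, ∀ c ∈ posUnitBall T, ‖b * c‖ ≤ r) : prodNorm S T ≤ r :=
  Real.sSup_le (by rintro _ ⟨b, hb, c, hc, rfl⟩; exact h b hb c hc) hr

theorem exists_lt_norm_mul_of_lt_prodNorm {S T : Set A} {r : ℝ} (hr : 0 ≤ r)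
    (h : r < prodNorm S T) : ∃ b ∈ posUnitBall S, ∃ c ∈ posUnitBall T, r < ‖b * c‖ := by
  by_contra! hcon
  exact h.not_ge (prodNorm_le hr hcon)

variable [StarOrderedRing A]

theorem exists_of_mem_posUnitBall_map_inr {b : Unitization ℂ A}
    (hb : b ∈ posUnitBall (inUnitization B : Set (Unitization ℂ A))) :
    ∃ a ∈ posUnitBall (B : Set A), (a : Unitization ℂ A) = b := by
  obtain ⟨⟨a, ha, rfl⟩, h0, h1⟩ := hb
  exact ⟨a, ⟨ha, Unitization.inr_nonneg_iff.mp h0, by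
    rwa [← Unitization.norm_inr (𝕜 := ℂ)]⟩, rfl⟩

theorem inr_mem_posUnitBall_map_inr {a : A} (ha : a ∈ posUnitBall (B : Set A)) :
    (a : Unitization ℂ A) ∈ posUnitBall (inUnitization B : Set (Unitization ℂ A)) :=
  ⟨⟨a, ha.1, rfl⟩, Unitization.inr_nonneg_iff.mpr ha.2.1,
    by rw [Unitization.norm_inr]; exact ha.2.2⟩

/-- The non-unital form of `exists_almost_orthogonal_of_unital`. -/
theorem exists_almost_orthogonal {lam δ : ℝ} (hB : IsClosed (B : Set A))
    (hC : IsClosed (C : Set A))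
    (hsup : ∀ b ∈ posUnitBall (B : Set A), ∀ c ∈ posUnitBall (C : Set A), ‖b * c‖ ^ 2 ≤ lam)
    (hlam1 : lam ≤ 1) (hδ : 0 < δ) (hδlam : δ < lam) {b c : A}
    (hb : b ∈ posUnitBall (B : Set A)) (hc : c ∈ posUnitBall (C : Set A))
    (hbc : lam - δ < ‖b * c‖ ^ 2) :
    ∃ x e : A, ‖e‖ ≤ 1 ∧ (∀ b' ∈ posUnitBall (B : Set A), ‖b' * x‖ ^ 2 ≤ δ) ∧
      ‖x‖ ^ 2 ≤ 1 - lam + δ ∧ 1 - lam - 2 * (δ / lam) ≤ ‖star x * (c * e)‖ := by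
  have hsup' : ∀ b ∈ posUnitBall (inUnitization B : Set (Unitization ℂ A)),
      ∀ c ∈ posUnitBall (inUnitization C : Set (Unitization ℂ A)),
      ‖b * c‖ ^ 2 ≤ lam := by
    intro b₁ hb₁ c₁ hc₁
    obtain ⟨b₂, hb₂, rfl⟩ := exists_of_mem_posUnitBall_map_inr hb₁
    obtain ⟨c₂, hc₂, rfl⟩ := exists_of_mem_posUnitBall_map_inr hc₁
    rw [← Unitization.inr_mul, Unitization.norm_inr]
    exact hsup b₂ hb₂ c₂ hc₂
  have hN : IsClosed ((inUnitization (⊤ : NonUnitalStarSubalgebra ℂ A) :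
      NonUnitalStarSubalgebra ℂ (Unitization ℂ A)) : Set (Unitization ℂ A)) :=
    isClosed_map_inr (by simp)
  obtain ⟨x, ⟨x, -, rfl⟩, e, ⟨e, -, rfl⟩, h1, h2, h3, h4⟩ :=
    exists_almost_orthogonal_of_unital (isClosed_map_inr hB) (isClosed_map_inr hC) hN
      (NonUnitalStarSubalgebra.map_mono le_top) (NonUnitalStarSubalgebra.map_mono le_top) hsup'
      hlam1 hδ hδlam (inr_mem_posUnitBall_map_inr hb) (inr_mem_posUnitBall_map_inr hc)
      (by rwa [← Unitization.inr_mul, Unitization.norm_inr])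
  change ‖(e : Unitization ℂ A)‖ ≤ 1 at h1
  change ∀ b' ∈ _, ‖b' * (x : Unitization ℂ A)‖ ^ 2 ≤ δ at h2
  change ‖(x : Unitization ℂ A)‖ ^ 2 ≤ _ at h3
  change _ ≤ ‖star (x : Unitization ℂ A) * (c * (e : Unitization ℂ A))‖ at h4
  refine ⟨x, e, by simpa [Unitization.norm_inr] using h1, fun b' hb' => ?_,
    by simpa [Unitization.norm_inr] using h3, ?_⟩
  · have := h2 _ (inr_mem_posUnitBall_map_inr hb')
    rwa [← Unitization.inr_mul, Unitization.norm_inr] at this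
  · rwa [← Unitization.inr_star, ← Unitization.inr_mul, ← Unitization.inr_mul,
      Unitization.norm_inr] at h4

/-- If `‖BC‖ = 0`, then `B` and `C` are orthogonal and both cuts can be taken inside `C`. -/
theorem exists_cut_of_prodNorm_eq_zero (hC : IsClosed (C : Set A)) (hC0 : (C : Set A) ≠ {0})
    (h0 : prodNorm (B : Set A) (C : Set A) = 0) :
    ∃ h f : A, 0 ≤ h ∧ ‖h‖ ≤ 1 ∧ 0 ≤ f ∧ ‖f‖ ≤ 1 ∧ h * f = f ∧
      (∀ b ∈ posUnitBall (B : Set A), ‖b * h‖ ≤ 0) ∧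
      ∃ c ∈ posUnitBall (C : Set A), 1 ≤ ‖c * f‖ ^ 2 := by
  obtain ⟨c, hc, hc0⟩ : ∃ c ∈ C, c ≠ 0 := by
    by_contra! hcon
    exact hC0 (Set.eq_singleton_iff_unique_mem.mpr ⟨zero_mem C, hcon⟩)
  have haC : star c * c ∈ C := mul_mem (star_mem hc) hc
  have ha0 : 0 ≤ star c * c := star_mul_self_nonneg c
  set a := star c * c
  have ht : 0 < ‖a‖ := norm_pos_iff.mpr ((CStarRing.star_mul_self_ne_zero_iff c).mpr hc0)
  have hfC : cut (‖a‖ / 2) ‖a‖ a ∈ posUnitBall (C : Set A) :=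
    ⟨cut_mem _ _ hC haC, cut_nonneg _ _ _, norm_cut_le_one _ _ _⟩
  have hhC : cut (‖a‖ / 4) (‖a‖ / 2) a ∈ posUnitBall (C : Set A) :=
    ⟨cut_mem _ _ hC haC, cut_nonneg _ _ _, norm_cut_le_one _ _ _⟩
  refine ⟨cut (‖a‖ / 4) (‖a‖ / 2) a, cut (‖a‖ / 2) ‖a‖ a, hhC.2.1, hhC.2.2, hfC.2.1, hfC.2.2,
    cut_mul_cut (by linarith) (by linarith) (by linarith) a,
    fun b hb => h0 ▸ norm_mul_le_prodNorm hb hhC, _, hfC, ?_⟩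
  have h1 := CStarRing.norm_star_mul_self (x := cut (‖a‖ / 2) ‖a‖ a)
  rw [(cut_isSelfAdjoint _ _ a).star_eq, norm_cut_eq_one (by linarith) (by linarith) ha0 le_rfl]
    at h1
  rw [h1]; norm_num

/-- There are spectral cuts `h` and `f` of a single positive element, the first acting as a unit on
the second, such that `h` is almost orthogonal to `B` while `f` is as close to `C` as the angle
between `B` and `C` allows. The element cut is `x x^*`, with `x` from `exists_almost_orthogonal`. -/
theorem exists_cut (hB : IsClosed (B : Set A)) (hC : IsClosed (C : Set A))
    (hC0 : (C : Set A) ≠ {0}) (hlam : prodNorm (B : Set A) (C : Set A) ^ 2 < 1) {ε : ℝ}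
    (hε : 0 < ε) :
    ∃ h f : A, 0 ≤ h ∧ ‖h‖ ≤ 1 ∧ 0 ≤ f ∧ ‖f‖ ≤ 1 ∧ h * f = f ∧
      (∀ b ∈ posUnitBall (B : Set A), ‖b * h‖ ≤ ε) ∧
      ∃ c ∈ posUnitBall (C : Set A),
        1 - prodNorm (B : Set A) (C : Set A) ^ 2 - ε ≤ ‖c * f‖ ^ 2 := by
  have hr := prodNorm_nonneg (B : Set A) (C : Set A)
  set r := prodNorm (B : Set A) (C : Set A) with hr_def
  rcases hr.eq_or_lt with h0 | hrpos
  · obtain ⟨h, f, h1, h2, h3, h4, h5, h6, c, hc, h7⟩ :=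
      exists_cut_of_prodNorm_eq_zero hC hC0 h0.symm
    refine ⟨h, f, h1, h2, h3, h4, h5, fun b hb => (h6 b hb).trans hε.le, c, hc, ?_⟩
    linarith [sq_nonneg r]
  set lam := r ^ 2 with hlam_def
  have hlam0 : 0 < lam := by positivity
  have hsup : ∀ b ∈ posUnitBall (B : Set A), ∀ c ∈ posUnitBall (C : Set A),
      ‖b * c‖ ^ 2 ≤ lam := fun b hb c hc =>
    pow_le_pow_left₀ (norm_nonneg _) (norm_mul_le_prodNorm hb hc) 2
  -- All error terms are at most `η`, where `(L - η)² ≥ (L + η) (L - 3 η)` for `L = 1 - lam`.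
  obtain ⟨η, hη0, hηε, hηL⟩ : ∃ η : ℝ, 0 < η ∧ 3 * η ≤ ε ∧ η ≤ 1 - lam := by
    refine ⟨min (ε / 3) (1 - lam), lt_min (by linarith) (by linarith), ?_, min_le_right _ _⟩
    linarith [min_le_left (ε / 3) (1 - lam)]
  -- The level `κ` of the cuts only depends on `η`; the error `δ` is chosen small compared to it.
  set κ := η ^ 2 / 8 with hκ
  have hκ0 : 0 < κ := by positivity
  obtain ⟨δ, hδ0, hδ1, hδ2⟩ : ∃ δ : ℝ, 0 < δ ∧ δ ≤ η * lam / 4 ∧ δ ≤ κ * ε ^ 2 / 2 :=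
    ⟨min (η * lam / 4) (κ * ε ^ 2 / 2), lt_min (by positivity) (by positivity),
      min_le_left _ _, min_le_right _ _⟩
  have hδη : δ ≤ η := by nlinarith
  have hδlam : δ < lam := by nlinarith
  obtain ⟨b, hb, c, hc, hbc⟩ : ∃ b ∈ posUnitBall (B : Set A), ∃ c ∈ posUnitBall (C : Set A),
      lam - δ < ‖b * c‖ ^ 2 := by
    obtain ⟨b, hb, c, hc, h⟩ := exists_lt_norm_mul_of_lt_prodNorm (Real.sqrt_nonneg (lam - δ))
      (show _ < prodNorm (B : Set A) (C : Set A) by rw [Real.sqrt_lt' hrpos]; linarith)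
    exact ⟨b, hb, c, hc, (Real.sqrt_lt' ((Real.sqrt_nonneg _).trans_lt h)).mp h⟩
  obtain ⟨x, e, he, hx1, hx2, hx3⟩ :=
    exists_almost_orthogonal hB hC hsup hlam.le hδ0 hδlam hb hc hbc
  set d := x * star x with hd
  have hdsa : IsSelfAdjoint d := IsSelfAdjoint.mul_star_self x
  refine ⟨cut (κ / 2) κ d, cut κ (2 * κ) d, cut_nonneg _ _ _, norm_cut_le_one _ _ _,
    cut_nonneg _ _ _, norm_cut_le_one _ _ _,
    cut_mul_cut (by linarith) (by linarith) (by linarith) d, fun b' hb' => ?_, c, hc, ?_⟩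
  · rw [cut_eq_mul_cutDiv (by linarith) (by linarith) hdsa, hd, mul_assoc, ← mul_assoc]
    have h1 := hx1 b' hb'
    have h2 := norm_star_mul_cutDiv_sq_le (half_pos hκ0) (half_lt_self hκ0) x
    refine (norm_mul_le _ _).trans ?_
    refine abs_le_of_sq_le_sq' ?_ hε.le |>.2
    rw [mul_pow]
    calc _ ≤ δ * (1 / (κ / 2)) := mul_le_mul h1 h2 (sq_nonneg _) hδ0.le
      _ ≤ κ * ε ^ 2 / 2 * (1 / (κ / 2)) := by gcongr
      _ = ε ^ 2 := by field_simp
  · set f := cut κ (2 * κ) d with hf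
    have hfs : star f = f := (cut_isSelfAdjoint _ _ d).star_eq
    have hcs : star c = c := (IsSelfAdjoint.of_nonneg hc.2.1).star_eq
    have hfc : ‖f * c‖ = ‖c * f‖ := by
      rw [← norm_star, star_mul, hfs, hcs]
    have h1 : ‖x - f * x‖ ≤ η / 2 := by
      have := norm_sub_cut_mul_sq_le hκ0 (by linarith : κ < 2 * κ) x
      refine abs_le_of_sq_le_sq' (this.trans (le_of_eq ?_)) (by positivity) |>.2
      rw [hκ]; ring
    have hce : ‖c * e‖ ≤ 1 :=
      (norm_mul_le c e).trans (mul_le_one₀ hc.2.2 (norm_nonneg _) he)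
    have h2 : ‖star x * (c * e)‖ ≤ η / 2 + ‖x‖ * ‖c * f‖ := by
      have e1 : star x * (c * e) = star (x - f * x) * (c * e) + star x * (f * c * e) := by
        rw [star_sub, star_mul, hfs]; noncomm_ring
      rw [e1, ← hfc]
      refine (norm_add_le _ _).trans (add_le_add ?_ ?_)
      · refine (norm_mul_le _ _).trans ?_
        rw [norm_star]
        nlinarith [norm_nonneg (c * e), norm_nonneg (x - f * x)]
      · refine (norm_mul_le _ _).trans ?_
        rw [norm_star]
        refine mul_le_mul_of_nonneg_left ((norm_mul_le _ _).trans ?_) (norm_nonneg _)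
        exact mul_le_of_le_one_right (norm_nonneg _) he
    have h3 : 2 * (δ / lam) ≤ η / 2 := by
      have : δ / lam ≤ η / 4 := by rw [div_le_iff₀ hlam0]; linarith
      linarith
    have h4 : 1 - lam - η ≤ ‖x‖ * ‖c * f‖ := by linarith
    have h5 : (1 - lam - η) ^ 2 ≤ ‖x‖ ^ 2 * ‖c * f‖ ^ 2 := by
      rw [← mul_pow]
      exact pow_le_pow_left₀ (by linarith) h4 2
    have h6 : (1 - lam - η) ^ 2 ≤ (1 - lam + η) * ‖c * f‖ ^ 2 :=
      h5.trans (mul_le_mul_of_nonneg_right (by linarith) (sq_nonneg _))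
    have h7 : (1 - lam + η) * (1 - lam - 3 * η) ≤ (1 - lam + η) * ‖c * f‖ ^ 2 := by
      nlinarith
    have h8 := le_of_mul_le_mul_left h7 (by linarith)
    linarith

end NonUnital

/-! ### Annihilators and separation -/

section AnnihilatorLemmas

variable {A : Type u} [NonUnitalCStarAlgebra A]

/-- The annihilator of `T` as a *-subalgebra. -/
def perpSubalgebra (T : Set A) : NonUnitalStarSubalgebra ℂ A where
  carrier := perp T
  zero_mem' := by intro t _; simp
  add_mem' := by
    intro a b ha hb t ht
    simp [mul_add, ha t ht, hb t ht]
  mul_mem' := by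
    intro a b ha hb t ht
    simp [← mul_assoc, ha t ht, hb t ht]
  smul_mem' := by
    intro r a ha t ht
    simp [mul_smul_comm, ha t ht]
  star_mem' := by
    intro a ha t ht
    simp [ha t ht]

theorem isClosed_perp (T : Set A) : IsClosed (perp T) := by
  have h : perp T = ⋂ t ∈ T, {s | t * star s = 0} ∩ {s | t * s = 0} := by
    ext s; simp [perp]
  rw [h]
  exact isClosed_biInter fun t _ =>
    (isClosed_eq (by fun_prop) continuous_const).inter (isClosed_eq (by fun_prop) continuous_const)

theorem isAnnihilator_univ : IsAnnihilator (Set.univ : Set A) :=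
  ⟨∅, by simp [perp]⟩

theorem mem_perp_perp_singleton {f : A} (hf : IsSelfAdjoint f) : f ∈ perp (perp {f}) := by
  intro t ht
  have h := congrArg star (ht f rfl).1
  rw [star_mul, star_star, hf.star_eq, star_zero] at h
  exact ⟨by rw [hf.star_eq, h], h⟩

/-- If `h` acts as a unit on `f`, then it does so on the annihilator generated by `f`: for `s` in
this annihilator and `w = (1 - h) s`, the element `(1 - h) w w^* (1 - h)` is orthogonal to `f`, and
hence annihilates `s`. -/
theorem mul_eq_of_mem_perp_perp {h f : A} (hh : IsSelfAdjoint h) (hf : IsSelfAdjoint f)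
    (hhf : h * f = f) {s : A} (hs : s ∈ perp (perp {f})) : h * s = s := by
  have hfh : f * h = f := by
    have := congrArg star hhf
    rwa [star_mul, hh.star_eq, hf.star_eq] at this
  set w := s - h * s with hw
  set v := w - h * w with hv
  have hfv : f * v = 0 := by
    rw [hv, mul_sub, ← mul_assoc, hfh, sub_self]
  have hmem : v * star v ∈ perp {f} := by
    rintro t rfl
    rw [star_mul, star_star, ← mul_assoc, hfv]
    simp
  have h0 : v * star v * s = 0 := (hs _ hmem).2
  have h1 : star v * s = 0 := by
    rw [← CStarRing.star_mul_self_eq_zero_iff]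
    rw [star_mul, star_star, mul_assoc, ← mul_assoc v, h0, mul_zero]
  have h2 : star v * s = star w * w := by
    have hs' := hh.star_eq
    rw [hv, hw]
    simp only [star_sub, star_mul, hs']
    noncomm_ring
  rw [h2, CStarRing.star_mul_self_eq_zero_iff] at h1
  exact (sub_eq_zero.mp h1).symm

variable [PartialOrder A]

theorem prodNorm_le_one (S T : Set A) : prodNorm S T ≤ 1 :=
  prodNorm_le zero_le_one fun b hb c hc =>
    (norm_mul_le b c).trans (mul_le_one₀ hb.2.2 (norm_nonneg c) hc.2.2)

theorem prodNorm_singleton_zero (S : Set A) : prodNorm S ({0} : Set A) = 0 :=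
  le_antisymm (prodNorm_le le_rfl fun b _ c hc => by
    rw [Set.mem_singleton_iff.mp hc.1, mul_zero, norm_zero]) (prodNorm_nonneg _ _)

theorem sep_bddBelow (S : Set A) :
    BddBelow {r : ℝ | ∃ D : Set A, IsAnnihilator D ∧ D ≠ {0} ∧ r = prodNorm S D} :=
  ⟨0, by rintro _ ⟨D, -, -, rfl⟩; exact prodNorm_nonneg _ _⟩

theorem sep_nonneg (S : Set A) : 0 ≤ sep S :=
  Real.sInf_nonneg (by rintro _ ⟨D, -, -, rfl⟩; exact prodNorm_nonneg _ _)

variable [StarOrderedRing A] {B C : NonUnitalStarSubalgebra ℂ A}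

/-- An annihilator that is almost orthogonal to `B` and close to `C`. -/
theorem exists_annihilator (hB : IsClosed (B : Set A)) (hC : IsClosed (C : Set A))
    (hC0 : (C : Set A) ≠ {0}) (hlam : prodNorm (B : Set A) (C : Set A) ^ 2 < 1) {ε : ℝ}
    (hε : 0 < ε) :
    ∃ D : Set A, IsAnnihilator D ∧ prodNorm (B : Set A) D ≤ ε ∧
      1 - prodNorm (B : Set A) (C : Set A) ^ 2 - ε ≤ prodNorm (C : Set A) D ^ 2 := by
  obtain ⟨h, f, hh0, -, hf0, hf1, hhf, hBh, c, hc, hcf⟩ := exists_cut hB hC hC0 hlam hε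
  have hfD : f ∈ perp (perp {f}) := mem_perp_perp_singleton (IsSelfAdjoint.of_nonneg hf0)
  refine ⟨perp (perp {f}), ⟨_, rfl⟩, prodNorm_le hε.le fun b hb s hs => ?_, hcf.trans
    (pow_le_pow_left₀ (norm_nonneg _) (norm_mul_le_prodNorm hc ⟨hfD, hf0, hf1⟩) 2)⟩
  rw [← mul_eq_of_mem_perp_perp (IsSelfAdjoint.of_nonneg hh0) (IsSelfAdjoint.of_nonneg hf0) hhf
    hs.1, ← mul_assoc]
  exact (norm_mul_le _ _).trans ((mul_le_of_le_one_right (norm_nonneg _) hs.2.2).trans (hBh b hb))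

/-- If some nonzero annihilator `C` has `‖BC‖ < 1`, it can be exchanged for one almost orthogonal
to `B`. -/
theorem sep_eq_zero_or_one (hB : IsClosed (B : Set A)) :
    sep (B : Set A) = 0 ∨ sep (B : Set A) = 1 := by
  by_cases hex : ∃ D : Set A, IsAnnihilator D ∧ D ≠ {0} ∧ prodNorm (B : Set A) D < 1
  · obtain ⟨D, ⟨T, rfl⟩, hD0, hD1⟩ := hex
    have hr := prodNorm_nonneg (B : Set A) (perp T)
    have hlam : prodNorm (B : Set A) (perpSubalgebra T : Set A) ^ 2 < 1 :=
      pow_lt_one₀ hr hD1 two_ne_zero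
    refine Or.inl (le_antisymm (le_of_forall_pos_le_add fun ε hε => ?_) (sep_nonneg _))
    set lam := prodNorm (B : Set A) (perpSubalgebra T : Set A) ^ 2 with hlam_def
    have hε' : 0 < min ε ((1 - lam) / 2) := lt_min hε (by linarith)
    obtain ⟨D, hD, hBD, hCD⟩ :=
      exists_annihilator (C := perpSubalgebra T) hB (isClosed_perp T) hD0 hlam hε'
    have hne : D ≠ {0} := by
      rintro rfl
      rw [prodNorm_singleton_zero, ← hlam_def] at hCD
      linarith [min_le_right ε ((1 - lam) / 2)]
    rw [zero_add]
    exact (csInf_le (sep_bddBelow _) ⟨D, hD, hne, rfl⟩).trans (hBD.trans (min_le_left _ _))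
  · push Not at hex
    by_cases hA : (Set.univ : Set A) = {0}
    · left
      have hempty : {r : ℝ | ∃ D : Set A, IsAnnihilator D ∧ D ≠ {0} ∧
          r = prodNorm (B : Set A) D} = ∅ := by
        refine Set.eq_empty_of_forall_notMem ?_
        rintro _ ⟨D, ⟨T, rfl⟩, hD0, -⟩
        exact hD0 (Set.Subset.antisymm (hA ▸ Set.subset_univ _)
          (Set.singleton_subset_iff.mpr (zero_mem (perpSubalgebra T))))
      rw [sep, hempty, Real.sInf_empty]
    · right
      refine le_antisymm ((csInf_le (sep_bddBelow _) ⟨_, isAnnihilator_univ, hA, rfl⟩).trans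
        (prodNorm_le_one _ _)) (le_csInf ⟨_, _, isAnnihilator_univ, hA, rfl⟩ ?_)
      rintro _ ⟨D, hD, hD0, rfl⟩
      exact hex D hD hD0

end AnnihilatorLemmas

/-! ### Open projections -/

section ProjectionLemmas

variable {A : Type u} [NonUnitalCStarAlgebra A]

/-- The *-subalgebra of all elements `a` such that a self-adjoint element `q` acts as a two-sided
unit on the image of `a` under `φ`. -/
def unitSubalgebra {R : Type v} [NonUnitalCStarAlgebra R] (φ : A →⋆ₙₐ[ℂ] R) {q : R}
    (hq : IsSelfAdjoint q) : NonUnitalStarSubalgebra ℂ A where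
  carrier := {a | φ a * q = φ a ∧ q * φ a = φ a}
  zero_mem' := by simp
  add_mem' := by
    rintro a b ⟨ha, ha'⟩ ⟨hb, hb'⟩
    simp [add_mul, mul_add, *]
  mul_mem' := by
    rintro a b ⟨ha, ha'⟩ ⟨hb, hb'⟩
    exact ⟨by rw [map_mul, mul_assoc, hb], by rw [map_mul, ← mul_assoc, ha']⟩
  smul_mem' := by
    rintro r a ⟨ha, ha'⟩
    exact ⟨by rw [map_smul, smul_mul_assoc, ha], by rw [map_smul, mul_smul_comm, ha']⟩
  star_mem' := by
    rintro a ⟨ha, ha'⟩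
    have h1 := congrArg star ha
    have h2 := congrArg star ha'
    rw [star_mul, hq.star_eq, ← map_star] at h1 h2
    exact ⟨h2, h1⟩

theorem isClosed_unitSubalgebra {R : Type v} [NonUnitalCStarAlgebra R] (φ : A →⋆ₙₐ[ℂ] R)
    (hφ : Continuous φ) {q : R} (hq : IsSelfAdjoint q) :
    IsClosed (unitSubalgebra φ hq : Set A) :=
  (isClosed_eq (by fun_prop) hφ).inter (isClosed_eq (by fun_prop) hφ)

/-- If `w h` has norm at most `ε`, then `w²` is, up to `2 ε²`, at most a multiple of
`(1 - h)²`. -/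
theorem mul_self_le_of_norm_mul_le {M : Type v} [CStarAlgebra M] [PartialOrder M]
    [StarOrderedRing M] {w h : M} (hw0 : 0 ≤ w) (hw1 : ‖w‖ ≤ 1) (hh : 0 ≤ h) (hh1 : h ≤ 1) {ε : ℝ}
    (hwh : ‖w * h‖ ≤ ε) :
    w * w ≤ (2 : ℝ) • ((1 - h) * (1 - h)) + (2 * ε ^ 2) • (1 : M) := by
  have hws := (IsSelfAdjoint.of_nonneg hw0).star_eq
  have hhs := (IsSelfAdjoint.of_nonneg hh).star_eq
  have hww : w * w ≤ 1 := by
    have hw := (CStarAlgebra.norm_le_one_iff_of_nonneg w hw0).mp hw1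
    exact (mul_self_le_self hw0 hw).trans hw
  have h1 : (1 - h) * (w * w) * (1 - h) ≤ (1 - h) * (1 - h) := by
    simpa only [mul_one] using conjugate_le_conjugate_of_nonneg hww (sub_nonneg.mpr hh1)
  have h2 : h * (w * w) * h ≤ (ε ^ 2) • (1 : M) := by
    have e1 : h * (w * w) * h = star (w * h) * (w * h) := by
      rw [star_mul, hws, hhs]; simp only [mul_assoc]
    rw [e1, ← Algebra.algebraMap_eq_smul_one]
    exact CStarAlgebra.star_mul_le_algebraMap_norm_sq.trans
      (algebraMap_mono M (pow_le_pow_left₀ (norm_nonneg _) hwh 2))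
  -- The parallelogram identity for `w = w (1 - h) + w h`.
  have h3 : 0 ≤ star (w - (2 : ℝ) • (w * h)) * (w - (2 : ℝ) • (w * h)) := star_mul_self_nonneg _
  have e3 : star (w - (2 : ℝ) • (w * h)) * (w - (2 : ℝ) • (w * h))
      = (2 : ℝ) • ((1 - h) * (w * w) * (1 - h) + h * (w * w) * h) - w * w := by
    simp only [two_smul, star_sub, star_add, star_mul, hws, hhs]
    noncomm_ring
  rw [e3, sub_nonneg] at h3
  refine h3.trans ((smul_le_smul_of_nonneg_left (add_le_add h1 h2) zero_le_two).trans
    (le_of_eq ?_))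
  module

variable {H : Type v} [NormedAddCommGroup H] [InnerProductSpace ℂ H] [CompleteSpace H]
variable {π : A →⋆ₙₐ[ℂ] (H →L[ℂ] H)} {p : H →L[ℂ] H}

theorem continuous_of_injective (hπ : Function.Injective π) : Continuous π :=
  (AddMonoidHomClass.isometry_of_norm π (NonUnitalStarAlgHom.norm_map π hπ)).continuous

variable [PartialOrder A] [StarOrderedRing A]

theorem map_nonneg_of_nonneg (π : A →⋆ₙₐ[ℂ] (H →L[ℂ] H)) {a : A} (ha : 0 ≤ a) : 0 ≤ π a := by
  obtain ⟨w, hw, rfl⟩ := CStarAlgebra.nonneg_iff_eq_star_mul_self.mp ha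
  rw [map_mul, map_star]
  exact star_mul_self_nonneg _

/-- If `h` is almost orthogonal to `p A p ∩ A` and acts as a unit on `f`, then `f` is almost
orthogonal to the open projection `p` itself. No strong limit is needed: by
`mul_self_le_of_norm_mul_le`, an upper bound of the operators with supremum `p` can be written
down in terms of `h`. -/
theorem norm_mul_openProjection_sq_le (hπ : Function.Injective π) (hp : IsOpenProjection π p)
    {h f : A} {ε : ℝ} (hh0 : 0 ≤ h) (hh1 : ‖h‖ ≤ 1) (hf0 : 0 ≤ f) (hhf : h * f = f)
    (hBh : ∀ b ∈ posUnitBall (unitSubalgebra π hp.1.isSelfAdjoint : Set A), ‖b * h‖ ≤ ε) :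
    ‖π f * p‖ ^ 2 ≤ 2 * ε ^ 2 * ‖f‖ ^ 2 := by
  obtain ⟨hproj, S, hS, -, -, hlub⟩ := id hp
  have hnorm := NonUnitalStarAlgHom.norm_map π hπ
  have hB := isClosed_unitSubalgebra π (continuous_of_injective hπ) hp.1.isSelfAdjoint
  have hh1' : π h ≤ 1 :=
    (CStarAlgebra.norm_le_one_iff_of_nonneg _ (map_nonneg_of_nonneg π hh0)).mp (by rwa [hnorm])
  have hple : p ≤ (2 : ℝ) • ((1 - π h) * (1 - π h)) + (2 * ε ^ 2) • (1 : H →L[ℂ] H) := by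
    refine hlub.2 ?_
    rintro _ ⟨s, hs, rfl⟩
    have hs' := hS hs
    have hsB : s ∈ unitSubalgebra π hp.1.isSelfAdjoint :=
      hproj.mul_right_and_mul_left_of_nonneg_of_le (map_nonneg_of_nonneg π hs'.2.1)
        (hlub.1 ⟨s, hs, rfl⟩)
    obtain ⟨w, hw, rfl⟩ := exists_sqrt_mem hB hsB hs'.2.1 hs'.2.2
    rw [map_mul]
    refine mul_self_le_of_norm_mul_le (map_nonneg_of_nonneg π hw.2.1) (by rw [hnorm]; exact hw.2.2)
      (map_nonneg_of_nonneg π hh0) hh1' ?_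
    rw [← map_mul, hnorm]
    exact hBh w hw
  have hf0' := map_nonneg_of_nonneg π hf0
  have hfs : star (π f) = π f := (IsSelfAdjoint.of_nonneg hf0').star_eq
  have hps : star p = p := hp.1.isSelfAdjoint.star_eq
  have hpp : p * p = p := hp.1.isIdempotentElem
  have h1 := conjugate_le_conjugate_of_nonneg hple hf0'
  have hhf' : (1 - π h) * π f = 0 := by rw [sub_mul, one_mul, ← map_mul, hhf, sub_self]
  have e1 : π f * ((2 : ℝ) • ((1 - π h) * (1 - π h)) + (2 * ε ^ 2) • (1 : H →L[ℂ] H)) * π f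
      = (2 * ε ^ 2) • (π f * π f) := by
    simp only [mul_add, add_mul, mul_smul_comm, smul_mul_assoc, mul_assoc, hhf', mul_zero,
      smul_zero, zero_add, one_mul]
  rw [e1] at h1
  have e2 : (π f * p) * star (π f * p) = π f * p * π f := by
    rw [star_mul, hps, hfs, ← mul_assoc, mul_assoc (π f) p p, hpp]
  rw [pow_two, ← CStarRing.norm_self_mul_star, e2]
  refine (CStarAlgebra.norm_le_norm_of_nonneg_of_le (e2 ▸ mul_star_self_nonneg _) h1).trans ?_
  rw [norm_smul, Real.norm_of_nonneg (by positivity), ← hnorm f]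
  refine mul_le_mul_of_nonneg_left ?_ (by positivity)
  rw [pow_two]
  exact norm_mul_le _ _

/-- If some `a` has `‖a p‖ ≠ ‖a‖`, then a positive element of norm one has this property. -/
theorem exists_nonneg_norm_mul_lt_one (hπ : Function.Injective π) (hp : IsStarProjection p) {a : A}
    (ha : ‖π a * p‖ ≠ ‖π a‖) : ∃ d : A, 0 ≤ d ∧ ‖d‖ = 1 ∧ ‖π d * p‖ < 1 := by
  have hnorm := NonUnitalStarAlgHom.norm_map π hπ
  have hp1 : ‖p‖ ≤ 1 := hp.norm_le
  have hlt : ‖π a * p‖ < ‖a‖ := by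
    rw [← hnorm a]
    exact lt_of_le_of_ne ((norm_mul_le _ _).trans (mul_le_of_le_one_right (norm_nonneg _) hp1)) ha
  have hpos : 0 < ‖a‖ := (norm_nonneg _).trans_lt hlt
  refine ⟨(‖a‖ ^ 2)⁻¹ • (star a * a), smul_nonneg (by positivity) (star_mul_self_nonneg a), ?_, ?_⟩
  · rw [norm_smul, CStarRing.norm_star_mul_self, Real.norm_of_nonneg (by positivity)]
    field_simp
  · have e1 : π ((‖a‖ ^ 2)⁻¹ • (star a * a)) * p = (‖a‖ ^ 2)⁻¹ • (star (π a) * (π a * p)) := by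
      have := map_smul π (((‖a‖ ^ 2)⁻¹ : ℝ) : ℂ) (star a * a)
      rw [Complex.coe_smul, Complex.coe_smul] at this
      rw [this, map_mul, map_star, smul_mul_assoc, mul_assoc]
    rw [e1, norm_smul, Real.norm_of_nonneg (by positivity), inv_mul_lt_iff₀ (by positivity),
      mul_one]
    refine (norm_mul_le _ _).trans_lt ?_
    rw [norm_star, hnorm, pow_two]
    exact mul_lt_mul_of_pos_left hlt hpos

/-- If `p` is not regular, there is a nonzero closed *-subalgebra on which a cut of a suitable
positive element acts as a unit, and whose angle with `p A p ∩ A` is nonzero. -/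
theorem exists_subalgebra_prodNorm_lt_one (hπ : Function.Injective π) (hp : IsStarProjection p)
    {a : A} (ha : ‖π a * p‖ ≠ ‖π a‖) :
    ∃ C : NonUnitalStarSubalgebra ℂ A, IsClosed (C : Set A) ∧ (C : Set A) ≠ {0} ∧
      prodNorm (unitSubalgebra π hp.isSelfAdjoint : Set A) (C : Set A) < 1 := by
  obtain ⟨d, hd0, hd1, hdp⟩ := exists_nonneg_norm_mul_lt_one hπ hp ha
  have hnorm := NonUnitalStarAlgHom.norm_map π hπ
  obtain ⟨s, hs, hs1⟩ := exists_between hdp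
  have hs0 : 0 < s := (norm_nonneg _).trans_lt hs
  obtain ⟨t, hst, ht1⟩ := exists_between hs1
  have husa := cut_isSelfAdjoint s t d
  have hup : ‖π (cut s t d) * p‖ ≤ ‖π d * p‖ / s := by
    rw [cut_eq_cutDiv_mul hs0 hst (IsSelfAdjoint.of_nonneg hd0), map_mul, mul_assoc]
    refine (norm_mul_le _ _).trans ?_
    rw [hnorm, div_eq_mul_one_div, mul_comm]
    exact mul_le_mul_of_nonneg_left (norm_cutDiv_le hs0 t d) (norm_nonneg _)
  refine ⟨unitSubalgebra (NonUnitalStarAlgHom.id ℂ A) husa,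
    isClosed_unitSubalgebra _ continuous_id husa, fun h0 => ?_, ?_⟩
  -- A higher cut of `d` is a nonzero element of this subalgebra.
  · have h1 : cut t 1 d = 0 := by
      have huf := cut_mul_cut hs0 hst ht1 d
      have hfu := congrArg star huf
      rw [star_mul, husa.star_eq, (cut_isSelfAdjoint t 1 d).star_eq] at hfu
      exact Set.mem_singleton_iff.mp (h0 ▸ ⟨hfu, huf⟩)
    have h2 := norm_cut_eq_one (hs0.trans hst) ht1 hd0 hd1.ge
    rw [h1, norm_zero] at h2
    exact zero_ne_one h2
  · refine (prodNorm_le (by positivity) fun b hb c hc => ?_).trans_lt ((div_lt_one hs0).mpr hs)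
    obtain ⟨⟨-, hpb⟩, hb0, hb1⟩ := hb
    obtain ⟨⟨hcu, -⟩, hc0, hc1⟩ := hc
    have hcu' : c * cut s t d = c := hcu
    have e1 : ‖b * c‖ = ‖c * b‖ := by
      rw [← norm_star, star_mul, (IsSelfAdjoint.of_nonneg hb0).star_eq,
        (IsSelfAdjoint.of_nonneg hc0).star_eq]
    have e2 : π (c * b) = π c * (π (cut s t d) * p) * π b := by
      rw [map_mul]
      nth_rewrite 1 [← hcu']
      rw [map_mul, mul_assoc, mul_assoc, mul_assoc, hpb]
    rw [e1, ← hnorm, e2]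
    refine le_trans ?_ hup
    refine (norm_mul_le _ _).trans ((mul_le_of_le_one_right (norm_nonneg _) (by rwa [hnorm])).trans
      ((norm_mul_le _ _).trans (mul_le_of_le_one_left (norm_nonneg _) (by rwa [hnorm]))))

theorem isRegularProjection_or_isMaximallyNonRegular (hπ : Function.Injective π)
    (hp : IsOpenProjection π p) (hdense : IsDenseProjection π p) :
    IsRegularProjection π p ∨ IsMaximallyNonRegular π p := by
  -- The closure of `p` is the identity, so regularity says that `‖a p‖ = ‖a‖` for all `a`.
  by_cases hreg : ∀ a : A, ‖π a * p‖ = ‖π a‖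
  · exact Or.inl ⟨1, hdense, fun a => by rw [mul_one, hreg a]⟩
  refine Or.inr ⟨by rintro _ ⟨a, -, rfl⟩; exact norm_nonneg _, fun r hr => ?_⟩
  push Not at hreg
  obtain ⟨a, ha⟩ := hreg
  by_contra! hr0
  obtain ⟨C, hC, hC0, hlt⟩ := exists_subalgebra_prodNorm_lt_one hπ hp.1 ha
  have hB := isClosed_unitSubalgebra π (continuous_of_injective hπ) hp.1.isSelfAdjoint
  have hlam := pow_lt_one₀ (prodNorm_nonneg _ _) hlt two_ne_zero
  set lam := prodNorm (unitSubalgebra π hp.1.isSelfAdjoint : Set A) (C : Set A) ^ 2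
  obtain ⟨ε, hε0, hεr, hεlam⟩ : ∃ ε : ℝ, 0 < ε ∧ ε ≤ r / 2 ∧ ε ≤ (1 - lam) / 2 :=
    ⟨min (r / 2) ((1 - lam) / 2), lt_min (by linarith) (by linarith), min_le_left _ _,
      min_le_right _ _⟩
  obtain ⟨h, f, hh0, hh1, hf0, -, hhf, hBh, c, -, hcf⟩ := exists_cut hB hC hC0 hlam hε0
  have hfne : 0 < ‖f‖ := by
    refine norm_pos_iff.mpr ?_
    rintro rfl
    rw [mul_zero, norm_zero] at hcf
    linarith
  have hfp := norm_mul_openProjection_sq_le hπ hp hh0 hh1 hf0 hhf hBh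
  have hmem : r ≤ ‖f‖⁻¹ * ‖π f * p‖ := by
    refine hr ⟨((‖f‖⁻¹ : ℝ) : ℂ) • f, ?_, ?_⟩
    · rw [norm_smul, Complex.norm_real, norm_inv, norm_norm, inv_mul_cancel₀ hfne.ne']
    · rw [map_smul, smul_mul_assoc, norm_smul, Complex.norm_real, norm_inv, norm_norm]
  rw [le_inv_mul_iff₀ hfne] at hmem
  have h1 : (‖f‖ * r) ^ 2 ≤ 2 * ε ^ 2 * ‖f‖ ^ 2 :=
    (pow_le_pow_left₀ (by positivity) hmem 2).trans hfp
  have h2 : r ^ 2 ≤ 2 * ε ^ 2 := by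
    rw [mul_pow, mul_comm] at h1
    exact le_of_mul_le_mul_right h1 (by positivity)
  nlinarith

end ProjectionLemmas

theorem mainTheorem3 (A : Type u) [NonUnitalCStarAlgebra A] [PartialOrder A] [StarOrderedRing A] :
    (∀ B C : NonUnitalStarSubalgebra ℂ A, IsClosed (B : Set A) → IsClosed (C : Set A) →
      (C : Set A) ≠ {0} → prodNorm (B : Set A) (C : Set A) ^ 2 < 1 → ∀ ε : ℝ, 0 < ε →
        ∃ D : Set A, IsAnnihilator D ∧ prodNorm (B : Set A) D ≤ ε ∧
          1 - prodNorm (B : Set A) (C : Set A) ^ 2 - ε ≤ prodNorm (C : Set A) D ^ 2) ∧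
    (∀ B : NonUnitalStarSubalgebra ℂ A, IsClosed (B : Set A) →
      sep (B : Set A) = 0 ∨ sep (B : Set A) = 1) ∧
    (∀ (H : Type v) [NormedAddCommGroup H] [InnerProductSpace ℂ H] [CompleteSpace H]
      (π : A →⋆ₙₐ[ℂ] (H →L[ℂ] H)), Function.Injective π → IsNondegenerateRep π →
      ∀ p : H →L[ℂ] H, IsOpenProjection π p → IsDenseProjection π p →
        IsRegularProjection π p ∨ IsMaximallyNonRegular π p) := by
  refine ⟨fun B C hB hC hC0 hlam ε hε => exists_annihilator hB hC hC0 hlam hε,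
    fun B hB => sep_eq_zero_or_one hB, ?_⟩
  intro H _ _ _ π hπ _ p hp hdense
  exact isRegularProjection_or_isMaximallyNonRegular hπ hp hdense
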